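/- Let $T>0$, let $\mathcal X$ be a finite state space, let $\mathcal X_0\subseteq\mathcal X$ be nonempty, let $U:\mathcal X_0\to\mathbb R$, and let $\pi(x)=\frac1Z e^{-U(x)}1_{x\in\mathcal X_0}$ with $Z=\sum_{x\in\mathcal X_0}e^{-U(x)}$ be the target distribution. (For example $\mathcal X_0=\{1,\dots,N\}^D$ and $\mathcal X=\{1,\dots,N,\mathbf M\}^D$ with a mask token $\mathbf M$.) Path measures are probability measures on the space of càdlàg paths $\xi:[0,T]\to\mathcal X$ with the $\sigma$-algebra generated by the coordinates; $\mathbb P_t$ denotes the law of $\xi_t$ under $\mathbb P$. A path measure $\mathbb P$ is that of a continuous-time Markov chain (CTMC) with generator $Q=(Q_t)_{t\in[0,T]}$ and initial distribution $p_{\mathrm{init}}$ if $\mathbb P_0=p_{\mathrm{init}}$; each $Q_t$ has nonnegative off-diagonal entries and zero row sums; $(\xi_t)$ is Markov under $\mathbb P$; $Q_t(x,y)=\lim_{s\downarrow t}\frac{\mathbb P(\xi_s=y\mid\xi_t=x)-1_{x=y}}{s-t}$ for all $t\in[0,T)$, all $y$, and all $x$ with $\mathbb P(\xi_t=x)>0$;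 and $\xi_{t-}=\xi_t$ $\mathbb P$-a.s. for every fixed $t\in(0,T]$. Let $\mathbb P^0$ (the reference path measure) and $\mathbb P^u$ (the path measure of the learned sampler) be path measures of CTMCs with generators $Q^0$ and $Q^u$ and the same initial distribution $p_{\mathrm{init}}$. Assume $\pi\ll\mathbb P^0_T$, and let the optimal path measure $\mathbb P^*$ be defined by $$\frac{\mathrm d\mathbb P^*}{\mathrm d\mathbb P^0}(\xi)=\frac{\mathrm d\pi}{\mathrm d\mathbb P^0_T}(\xi_T).$$ Let $p_{\mathrm{samp}}:=\mathbb P^u_T$ be the distribution of the samples generated by the learned sampler. Then for every $\varepsilon\in\mathbb R$: 1. if $\operatorname{KL}(\mathbb P^u\|\mathbb P^*)\le\varepsilon^2$, then $\operatorname{KL}(p_{\mathrm{samp}}\|\pi)\le\varepsilon^2$; 2. if $\operatorname{KL}(\mathbb P^*\|\mathbb P^u)\le\varepsilon^2$, then $\operatorname{KL}(\pi\|p_{\mathrm{samp}})\le\varepsilon^2$. -/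

import Mathlib

open MeasureTheory ProbabilityTheory Filter Topology InformationTheory

/-- The time interval `[0, T]`. -/
abbrev Time (T : ℝ) : Type := Set.Icc (0 : ℝ) T

/-- The path `ξ : [0, T] → S` into a discrete space is càdlàg: right-continuous with left limits,
where convergence in `S` means being eventually constant. (For finite `S`, such a path is piecewise
constant with finitely many jumps. At the endpoints the one-sided filter is `⊥`.) -/
def IsCadlag {S : Type*} {T : ℝ} (ξ : Time T → S) : Prop :=
  (∀ t, ∀ᶠ s in 𝓝[>] t, ξ s = ξ t) ∧ (∀ t, ∃ x, ∀ᶠ s in 𝓝[<] t, ξ s = x)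

/-- The space of càdlàg trajectories `[0, T] → S`. -/
def PathSpace (S : Type*) (T : ℝ) : Type _ := {ξ : Time T → S // IsCadlag ξ}

/-- The coordinate (canonical) process: `coord t ξ = ξ_t`. -/
def coord {S : Type*} {T : ℝ} (t : Time T) (ξ : PathSpace S T) : S := ξ.1 t

/-- The σ-algebra on the path space generated by all the coordinates. -/
instance {S : Type*} [MeasurableSpace S] {T : ℝ} : MeasurableSpace (PathSpace S T) :=
  ⨆ t : Time T, MeasurableSpace.comap (coord t) inferInstance

/-- The σ-algebra generated by the coordinates `ξ_r`, `r ≤ s`. -/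
abbrev pastSigma (S : Type*) [MeasurableSpace S] {T : ℝ} (s : Time T) :
    MeasurableSpace (PathSpace S T) :=
  ⨆ r : {r : Time T // r ≤ s}, MeasurableSpace.comap (coord r.1) inferInstance

/-- The marginal distribution `P_t` of `ξ_t` under a path measure `P`. -/
noncomputable def marginal {S : Type*} [MeasurableSpace S] {T : ℝ}
    (P : Measure (PathSpace S T)) (t : Time T) : Measure S :=
  P.map (coord t)

/-- The initial time `0` of `[0, T]`. -/
def initialTime {T : ℝ} (hT : 0 < T) : Time T := ⟨0, le_rfl, hT.le⟩

/-- The final time `T` of `[0, T]`. -/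
def finalTime {T : ℝ} (hT : 0 < T) : Time T := ⟨T, hT.le, le_rfl⟩

/-- `P` is the path measure of a continuous-time Markov chain on the finite state space `S` over
`[0, T]` with time-dependent generator `Q` and initial distribution `pinit`. -/
structure IsCTMCPathMeasure {S : Type*} [Fintype S] [DecidableEq S] [MeasurableSpace S]
    {T : ℝ} (hT : 0 < T) (Q : Time T → Matrix S S ℝ) (pinit : Measure S)
    (P : Measure (PathSpace S T)) : Prop where
  isProbabilityMeasure : IsProbabilityMeasure P
  marginal_initial : marginal P (initialTime hT) = pinit
  /-- Nonnegative off-diagonal rates. -/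
  rate_nonneg : ∀ t x y, x ≠ y → 0 ≤ Q t x y
  /-- The diagonal entry is minus the total exit rate. -/
  rate_diag : ∀ t x, Q t x x = -∑ y ∈ Finset.univ.erase x, Q t x y
  /-- Markov property: given `ξ_s = x`, the future does not depend on any event of the past. -/
  markov : ∀ s t : Time T, s ≤ t → ∀ A, MeasurableSet[pastSigma S s] A → ∀ x y : S,
    P (A ∩ {ξ | coord s ξ = x}) ≠ 0 →
      P[{ξ | coord t ξ = y} | A ∩ {ξ | coord s ξ = x}]
        = P[{ξ | coord t ξ = y} | {ξ | coord s ξ = x}]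
  /-- `Q_t(x, y) = lim_{s ↓ t} (P(ξ_s = y | ξ_t = x) - 1_{x = y}) / (s - t)` for `t < T` and every
  state `x` that is occupied at time `t` with positive probability. -/
  generator : ∀ t : Time T, t < finalTime hT → ∀ x y : S, P {ξ | coord t ξ = x} ≠ 0 →
    Tendsto (fun s : Time T =>
        ((P[{ξ | coord s ξ = y} | {ξ | coord t ξ = x}]).toReal - if x = y then 1 else 0)
          / ((s : ℝ) - (t : ℝ)))
      (𝓝[>] t) (𝓝 (Q t x y))
  /-- No jump happens at a deterministic time: `ξ_{t-} = ξ_t` almost surely, for each `t`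
  (including `t = T`, where the rates are allowed to blow up). -/
  no_fixed_jump : ∀ t : Time T, ∀ᵐ ξ ∂P, ∀ᶠ s in 𝓝[<] t, coord s ξ = coord t ξ

/-- The normalizing constant `Z = ∑_{x ∈ X₀} exp(-U(x))`. -/
noncomputable def partitionFn {S : Type*} (X₀ : Finset S) (U : X₀ → ℝ) : ℝ :=
  ∑ x : X₀, Real.exp (-U x)

/-- The target distribution `π(x) = exp(-U(x)) / Z` on `X₀ ⊆ S`, as a measure on `S`. -/
noncomputable def targetMeasure {S : Type*} [MeasurableSpace S] (X₀ : Finset S) (U : X₀ → ℝ) :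
    Measure S :=
  ∑ x : X₀, ENNReal.ofReal (Real.exp (-U x) / partitionFn X₀ U) • Measure.dirac (x : S)

/-- The optimal path measure `P*(dξ) = (dπ/dP⁰_T)(ξ_T) P⁰(dξ)`. -/
noncomputable def optimalPathMeasure {S : Type*} [MeasurableSpace S] {T : ℝ} (hT : 0 < T)
    (P0 : Measure (PathSpace S T)) (π : Measure S) : Measure (PathSpace S T) :=
  P0.withDensity fun ξ => π.rnDeriv (marginal P0 (finalTime hT)) (coord (finalTime hT) ξ)

/-! Both bounds are the data processing inequality `klDiv_map_le` for the evaluation map at time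
`T`: a pushforward cannot increase KL divergence, in either argument order. The density of `P*`
depends on the path only through its endpoint, so reweighting commutes with taking the terminal
marginal, and `P*_T = π`. The Markov structure plays no role. -/

lemma measurable_coord {S : Type*} [MeasurableSpace S] {T : ℝ} (t : Time T) :
    Measurable (coord t : PathSpace S T → S) :=
  measurable_iff_comap_le.2
    (le_iSup (fun t : Time T => MeasurableSpace.comap (coord (S := S) t) inferInstance) t)

instance isFiniteMeasure_targetMeasure {S : Type*} [MeasurableSpace S] (X₀ : Finset S)
    (U : X₀ → ℝ) : IsFiniteMeasure (targetMeasure X₀ U) := by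
  unfold targetMeasure
  refine ⟨?_⟩
  simp [Measure.finsetSum_apply]

/-- The terminal marginal of the optimal path measure is the target. -/
lemma marginal_optimalPathMeasure {S : Type*} [MeasurableSpace S] {T : ℝ} (hT : 0 < T)
    (P0 : Measure (PathSpace S T)) [IsFiniteMeasure P0] (π : Measure S) [IsFiniteMeasure π]
    (hac : π ≪ marginal P0 (finalTime hT)) :
    marginal (optimalPathMeasure hT P0 π) (finalTime hT) = π := by
  have hmeas := measurable_coord (S := S) (finalTime hT)
  have : IsFiniteMeasure (marginal P0 (finalTime hT)) := by
    unfold marginal; infer_instance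
  -- Absolute continuity enters here: otherwise the density would recover only the part of `π` that
  -- is absolutely continuous with respect to `P0_T`. What remains is a change of variables along
  -- `coord`.
  conv_rhs => rw [← Measure.withDensity_rnDeriv_eq _ _ hac]
  ext s hs
  have hd := Measure.measurable_rnDeriv π (marginal P0 (finalTime hT))
  unfold optimalPathMeasure
  rw [marginal, Measure.map_apply hmeas hs, withDensity_apply _ (hmeas hs),
    withDensity_apply _ hs, ← setLIntegral_map hs hd hmeas, marginal]

/-- The optimal path measure has the same finite mass as the target. -/
lemma isFiniteMeasure_optimalPathMeasure {S : Type*} [MeasurableSpace S] {T : ℝ} (hT : 0 < T)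
    (P0 : Measure (PathSpace S T)) [IsFiniteMeasure P0] (π : Measure S) [IsFiniteMeasure π]
    (hac : π ≪ marginal P0 (finalTime hT)) :
    IsFiniteMeasure (optimalPathMeasure hT P0 π) := by
  refine ⟨?_⟩
  -- A pushforward preserves total mass, so the terminal marginal determines that of `P*`.
  have h := congrArg (fun μ : Measure S => μ Set.univ) (marginal_optimalPathMeasure hT P0 π hac)
  simp only [marginal, Measure.map_apply (measurable_coord _) MeasurableSet.univ,
    Set.preimage_univ] at h
  exact h ▸ measure_lt_top π Set.univ

theorem mainTheorem2 {S : Type*} [Fintype S] [DecidableEq S] [MeasurableSpace S]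
    [DiscreteMeasurableSpace S] {T : ℝ} (hT : 0 < T)
    (X₀ : Finset S) (hX₀ : X₀.Nonempty) (U : X₀ → ℝ)
    (pinit : Measure S) (Q0 Qu : Time T → Matrix S S ℝ)
    (P0 Pu : Measure (PathSpace S T))
    (hP0 : IsCTMCPathMeasure hT Q0 pinit P0)
    (hPu : IsCTMCPathMeasure hT Qu pinit Pu)
    (hac : targetMeasure X₀ U ≪ marginal P0 (finalTime hT))
    (ε : ℝ) :
    (klDiv Pu (optimalPathMeasure hT P0 (targetMeasure X₀ U)) ≤ ENNReal.ofReal (ε ^ 2) →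
      klDiv (marginal Pu (finalTime hT)) (targetMeasure X₀ U) ≤ ENNReal.ofReal (ε ^ 2)) ∧
    (klDiv (optimalPathMeasure hT P0 (targetMeasure X₀ U)) Pu ≤ ENNReal.ofReal (ε ^ 2) →
      klDiv (targetMeasure X₀ U) (marginal Pu (finalTime hT)) ≤ ENNReal.ofReal (ε ^ 2)) := by
  have := hP0.isProbabilityMeasure
  have := hPu.isProbabilityMeasure
  have hfin := isFiniteMeasure_optimalPathMeasure hT P0 (targetMeasure X₀ U) hac
  have hmarg := marginal_optimalPathMeasure hT P0 (targetMeasure X₀ U) hac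
  have hmeas := measurable_coord (S := S) (finalTime hT)
  have h₁ := klDiv_map_le (μ := Pu) (ν := optimalPathMeasure hT P0 (targetMeasure X₀ U)) hmeas
  have h₂ := klDiv_map_le (μ := optimalPathMeasure hT P0 (targetMeasure X₀ U)) (ν := Pu) hmeas
  -- Each `← marginal` folds the pushforward of one of the two path measures.
  rw [← marginal, ← marginal, hmarg] at h₁ h₂
  exact ⟨h₁.trans, h₂.trans⟩
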